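/- Let $n\ge 3$, $2\le d_1\le d_2\le\cdots\le d_n$, and let $\rho$ be a state (a positive semidefinite operator of trace one) on $\mathbb C^{d_1}\otimes\cdots\otimes\mathbb C^{d_n}$. For each site $i$ let $\lambda^{(i)}_1,\dots,\lambda^{(i)}_{d_i^2-1}$ be generators of $SU(d_i)$, that is, Hermitian traceless $d_i\times d_i$ matrices with $\mathrm{Tr}(\lambda^{(i)}_a\lambda^{(i)}_b)=2\delta_{ab}$, and put $$\big\|\mathbf T^{(12\cdots n)}\big\|^2=\sum_{a_1=1}^{d_1^2-1}\cdots\sum_{a_n=1}^{d_n^2-1}\Big|\mathrm{Tr}\big(\rho\,\lambda^{(1)}_{a_1}\otimes\cdots\otimes\lambda^{(n)}_{a_n}\big)\Big|^2 .$$ Let $\mathbf m=(k_1,\dots,k_m)$ with $1\le k_1\le\cdots\le k_m\le n-1$ and $\sum_{s}k_s=n$. An arrangement of type $\mathbf m$ is a partition $A=(B_1,\dots,B_m)$ of $\{1,\dots,n\}$ into blocks with $|B_j|=k_j$. The consecutive arrangement has $B_j=\{n_{j-1}+1,\dots,n_j\}$, where $n_j=k_1+\cdots+k_j$ and $n_0=0$.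 For a block $B$ of $t$ sites, whose dimensions in increasing order of the sites are $e_1\le\cdots\le e_t$, put $$a_B=\frac{2(e_1-1)}{e_1}\ (t=1),\qquad a_B=\frac{4(e_1^2-1)}{e_1^2}\ (t=2),$$ $$a_B=2^t\left\{1-\frac{\sum_{1\le i_1<\cdots<i_{t-1}\le t}e_{i_1}\cdots e_{i_{t-1}}-\sum_{i=1}^t e_i+(t-2)e_t}{(t-2)\,e_1\cdots e_{t-1}\,e_t^2}\right\}\ (t\ge3).$$ An arrangement is called admissible if $e_t\le e_1\cdots e_{t-1}$ for each of its blocks with $t\ge 3$ sites. 1. Suppose that the consecutive arrangement $(B_1,\dots,B_m)$ is admissible, and that $\rho=\sum_i p_i|\psi_i\rangle\langle\psi_i|$ (a finite sum, $p_i>0$, $\sum_ip_i=1$), where every $|\psi_i\rangle$ is a tensor product of $m$ normalized vectors of the spaces $\bigotimes_{l\in B_j}\mathbb C^{d_l}$, $j=1,\dots,m$. Then $$\big\|\mathbf T^{(12\cdots n)}\big\|^2\le\prod_{j=1}^m a_{B_j}.$$ 2. More generally, let $\mathcal S$ be a set of admissible arrangements of type $\mathbf m$, and suppose that $\rho=\sum_i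 p_i|\psi_i\rangle\langle\psi_i|$ as above, where each $|\psi_i\rangle$ is a tensor product of normalized vectors of the blocks of some arrangement in $\mathcal S$, which may depend on $i$. Then $$\big\|\mathbf T^{(12\cdots n)}\big\|^2\le\max_{A\in\mathcal S}\ \prod_{B\in A}a_B .$$ In particular, these inequalities are necessary conditions for $\mathbf m$-separability: with respect to one fixed arrangement $A$ (take $\mathcal S=\{A\}$), and with an unrestricted, possibly varying choice of the sites in the blocks (take $\mathcal S$ to be all arrangements of type $\mathbf m$, if all are admissible). -/

import Mathlib

open scoped Matrix ComplexOrder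

noncomputable section

/-- The product basis of `ℂ^{d₁} ⊗ ⋯ ⊗ ℂ^{dₙ}`; operators on this space are complex matrices
indexed by it, and vectors are complex functions on it. -/
abbrev TensorIndex {n : ℕ} (d : Fin n → ℕ) : Type := (i : Fin n) → Fin (d i)

/-- A (mixed) state: positive semidefinite with trace one. -/
structure IsState {ι : Type*} [Fintype ι] (ρ : Matrix ι ι ℂ) : Prop where
  posSemidef : ρ.PosSemidef
  trace_eq_one : ρ.trace = 1

/-- A choice of generators of `SU(d)`: `d² - 1` Hermitian traceless matrices with
`Tr (λ_a λ_b) = 2 δ_{ab}`. -/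
structure IsSUGenerators {d : ℕ} (lam : Fin (d ^ 2 - 1) → Matrix (Fin d) (Fin d) ℂ) : Prop where
  isHermitian : ∀ a, (lam a).IsHermitian
  trace_eq_zero : ∀ a, (lam a).trace = 0
  trace_mul : ∀ a b, (lam a * lam b).trace = if a = b then 2 else 0

/-- The tensor (Kronecker) product `M₁ ⊗ ⋯ ⊗ Mₙ`. -/
def tensorMatrix {n : ℕ} {d : Fin n → ℕ} (M : (i : Fin n) → Matrix (Fin (d i)) (Fin (d i)) ℂ) :
    Matrix (TensorIndex d) (TensorIndex d) ℂ :=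
  Matrix.of fun x y => ∏ i, M i (x i) (y i)

/-- The entry `t_{i₁⋯iₙ} = Tr (ρ λ_{i₁} ⊗ ⋯ ⊗ λ_{iₙ})` of the Bloch tensor `T^{(1⋯n)}`.
It is a real number when `ρ` and the `λ`s are Hermitian. -/
def blochEntry {n : ℕ} {d : Fin n → ℕ}
    (lam : (i : Fin n) → Fin (d i ^ 2 - 1) → Matrix (Fin (d i)) (Fin (d i)) ℂ)
    (ρ : Matrix (TensorIndex d) (TensorIndex d) ℂ) (a : (i : Fin n) → Fin (d i ^ 2 - 1)) : ℂ :=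
  (ρ * tensorMatrix fun i => lam i (a i)).trace

/-- The squared norm `‖T^{(1⋯n)}‖²` of the full Bloch tensor. -/
def blochNormSq {n : ℕ} {d : Fin n → ℕ}
    (lam : (i : Fin n) → Fin (d i ^ 2 - 1) → Matrix (Fin (d i)) (Fin (d i)) ℂ)
    (ρ : Matrix (TensorIndex d) (TensorIndex d) ℂ) : ℝ :=
  ∑ a : (i : Fin n) → Fin (d i ^ 2 - 1), ‖blochEntry lam ρ a‖ ^ 2

/-- An arrangement of the sites `1, …, n` into `m` blocks, the `j`-th block having `k j` sites:
`site ⟨j, a⟩` is the `a`-th site of block `j`, and the sites of a block are listed in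
increasing order. -/
structure Arrangement {m : ℕ} (k : Fin m → ℕ) (n : ℕ) where
  site : (Σ j : Fin m, Fin (k j)) ≃ Fin n
  strictMono : ∀ j, StrictMono fun a : Fin (k j) => site ⟨j, a⟩

/-- The arrangement into consecutive blocks: block `1` is `{1, …, k₁}`, block `2` is
`{k₁ + 1, …, k₁ + k₂}`, and so on. -/
def consecutive {m n : ℕ} (k : Fin m → ℕ) (h : ∑ j, k j = n) : Arrangement k n where
  site := finSigmaFinEquiv.trans (finCongr h)
  strictMono := by
    intro j a b hab
    have hab' : (a : ℕ) < (b : ℕ) := hab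
    rw [Fin.lt_def]
    simp only [Equiv.trans_apply, finCongr_apply, Fin.val_cast, finSigmaFinEquiv_apply]
    omega

/-- The dimensions of the sites of block `j`, in the order of the sites. -/
abbrev Arrangement.blockDims {m n : ℕ} {k : Fin m → ℕ} (A : Arrangement k n) (d : Fin n → ℕ)
    (j : Fin m) : Fin (k j) → ℕ :=
  fun a => d (A.site ⟨j, a⟩)

/-- The vector `⨂ⱼ φⱼ`, where `φⱼ` is a vector of the `j`-th block of the arrangement. -/
def Arrangement.productVector {m n : ℕ} {k : Fin m → ℕ} (A : Arrangement k n) (d : Fin n → ℕ)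
    (φ : (j : Fin m) → EuclideanSpace ℂ (TensorIndex (A.blockDims d j))) : TensorIndex d → ℂ :=
  fun x => ∏ j, φ j fun a => x (A.site ⟨j, a⟩)

/-- The pure state vector `ψ` is a tensor product of normalized vectors of the blocks of `A`. -/
def Arrangement.IsProduct {m n : ℕ} {k : Fin m → ℕ} (A : Arrangement k n) (d : Fin n → ℕ)
    (ψ : TensorIndex d → ℂ) : Prop :=
  ∃ φ : (j : Fin m) → EuclideanSpace ℂ (TensorIndex (A.blockDims d j)),
    (∀ j, ‖φ j‖ = 1) ∧ ψ = A.productVector d φ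

/-- `ρ` is separable over a set `S` of arrangements: `ρ = ∑ᵢ pᵢ |ψᵢ⟩⟨ψᵢ|` with `pᵢ > 0`,
`∑ᵢ pᵢ = 1`, where each `|ψᵢ⟩` is a product along some arrangement in `S`.  For
`S = Set.univ` this is `(k₁, …, k_m)`-separability, with unrestricted and possibly varying
choice of the sites in the blocks; for `S = {A}` all `|ψᵢ⟩` factor along the same blocks. -/
def IsSeparableOver {m n : ℕ} {k : Fin m → ℕ} (d : Fin n → ℕ) (S : Set (Arrangement k n))
    (ρ : Matrix (TensorIndex d) (TensorIndex d) ℂ) : Prop :=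
  ∃ (N : ℕ) (p : Fin N → ℝ) (ψ : Fin N → TensorIndex d → ℂ),
    (∀ i, 0 < p i) ∧ ∑ i, p i = 1 ∧ (∀ i, ∃ A ∈ S, A.IsProduct d (ψ i)) ∧
      ρ = ∑ i, (p i : ℂ) • Matrix.vecMulVec (ψ i) (star (ψ i))

/-- The dimension condition on a block with dimensions `e₁ ≤ ⋯ ≤ e_t`: if `t ≥ 3` then
`e_t ≤ e₁ ⋯ e_{t-1}`; nothing is required for smaller blocks. -/
def DimCondition : (t : ℕ) → (Fin t → ℕ) → Prop
  | t + 3, e => e (Fin.last (t + 2)) ≤ ∏ i : Fin (t + 2), e i.castSucc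
  | _, _ => True

/-- The constant of a block with dimensions `e₁ ≤ ⋯ ≤ e_t`: `2 (e₁ - 1) / e₁` for `t = 1`,
`4 (e₁² - 1) / e₁²` for `t = 2`, and for `t ≥ 3`
`2^t (1 - (∑ e_{i₁} ⋯ e_{i_{t-1}} - ∑ e_i + (t - 2) e_t) / ((t - 2) e₁ ⋯ e_{t-1} e_t²))`, the
first sum running over `i₁ < ⋯ < i_{t-1}`.  (The empty block is never used.) -/
def blockBound : (t : ℕ) → (Fin t → ℕ) → ℝ
  | 0, _ => 1
  | 1, e => 2 * ((e 0 : ℝ) - 1) / (e 0 : ℝ)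
  | 2, e => 2 ^ 2 * ((e 0 : ℝ) ^ 2 - 1) / (e 0 : ℝ) ^ 2
  | t + 3, e =>
      2 ^ (t + 3) *
        (1 - ((∑ s ∈ Finset.univ.powersetCard (t + 2), ∏ i ∈ s, (e i : ℝ))
                - ∑ i, (e i : ℝ) + ((t : ℝ) + 1) * (e (Fin.last (t + 2)) : ℝ)) /
              (((t : ℝ) + 1) * (∏ i : Fin (t + 2), (e i.castSucc : ℝ))
                * (e (Fin.last (t + 2)) : ℝ) ^ 2))

/-- Every block of the arrangement satisfies the dimension condition. -/
def Arrangement.DimOK {m n : ℕ} {k : Fin m → ℕ} (A : Arrangement k n) (d : Fin n → ℕ) : Prop :=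
  ∀ j, DimCondition (k j) (A.blockDims d j)

/-- The product of the block constants of the arrangement. -/
def Arrangement.bound {m n : ℕ} {k : Fin m → ℕ} (A : Arrangement k n) (d : Fin n → ℕ) : ℝ :=
  ∏ j, blockBound (k j) (A.blockDims d j)

end

/-! Squared coefficients in an orthonormal product basis of operators can be counted against
purities. At each site take the normalized identity and the generators divided by `√2`. For a pure
state the squared coefficients sum to 1, and those with no identity factor sum to `F = 2⁻ᵗ‖T‖²`. The
total weight `w(S)` of the terms with identities on `S` is the purity of the reduction to `S`,
divided by the dimension of `S` (`trivialWeight_eq`); that purity is the same for `S` and its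
complement.

Counting the identity factors of each term (`sum_ite_eq_none_le`) and summing gives, with `D = ∏
eᵢ`, `∑ w({i}) ≤ (t-2)(1-F) + ∑ w({i}ᶜ) - (t-2)/D`. Here `w({i}) - w({i}ᶜ) = p (1/eᵢ - eᵢ/D)`, where
`p ≥ 1/eᵢ` is the purity of site `i`; admissibility makes the bracket nonnegative, so `F` is bounded
above. One or two sites need only exact inclusion-exclusion. This is
`blochNormSq_pure_le_blockBound`.

For a product vector the Bloch tensor factors over the blocks, so its squared norm is the product of
the block norms (`Arrangement.blochNormSq_productVector`). Convexity (`blochNormSq_sum_le`) passes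
to mixtures. -/

noncomputable section

/-! ### Orthonormal operator bases at one site -/

/-- The orthonormal operator basis made of the normalized identity and normalized generators. -/
def orthonormalGenerator {d : ℕ} (lam : Fin (d ^ 2 - 1) → Matrix (Fin d) (Fin d) ℂ) :
    Option (Fin (d ^ 2 - 1)) → Matrix (Fin d) (Fin d) ℂ
  | none => ((√(d : ℝ))⁻¹ : ℂ) • 1
  | some a => ((√(2 : ℝ))⁻¹ : ℂ) • lam a

theorem ofReal_inv_sqrt_mul_self {r : ℝ} (hr : 0 ≤ r) :
    ((√r : ℝ) : ℂ)⁻¹ * ((√r : ℝ) : ℂ)⁻¹ = (r : ℂ)⁻¹ := by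
  rw [← mul_inv, ← Complex.ofReal_mul, Real.mul_self_sqrt hr]

theorem orthonormalGenerator_isHermitian {d : ℕ}
    {lam : Fin (d ^ 2 - 1) → Matrix (Fin d) (Fin d) ℂ} (h : IsSUGenerators lam)
    (o : Option (Fin (d ^ 2 - 1))) : (orthonormalGenerator lam o).IsHermitian := by
  cases o with
  | none => simp [orthonormalGenerator, Matrix.IsHermitian, Matrix.conjTranspose_smul]
  | some a =>
    simp [orthonormalGenerator, Matrix.IsHermitian, Matrix.conjTranspose_smul,
      (h.isHermitian a).eq]

theorem orthonormalGenerator_trace_mul {d : ℕ} (hd : d ≠ 0)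
    {lam : Fin (d ^ 2 - 1) → Matrix (Fin d) (Fin d) ℂ} (h : IsSUGenerators lam)
    (o o' : Option (Fin (d ^ 2 - 1))) :
    (orthonormalGenerator lam o * orthonormalGenerator lam o').trace = if o = o' then 1 else 0 := by
  have hd' : (d : ℂ) ≠ 0 := by exact_mod_cast hd
  have h1 := ofReal_inv_sqrt_mul_self (r := (d : ℝ)) (by positivity)
  have h2 := ofReal_inv_sqrt_mul_self (r := (2 : ℝ)) (by positivity)
  rcases o with _ | a <;> rcases o' with _ | b
  · simp only [orthonormalGenerator, Matrix.mul_smul, Matrix.trace_smul, mul_one,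
      Matrix.trace_one, smul_eq_mul, Fintype.card_fin, if_true, ← mul_assoc]
    rw [h1]; push_cast; exact inv_mul_cancel₀ hd'
  · simp [orthonormalGenerator, h.trace_eq_zero]
  · simp [orthonormalGenerator, h.trace_eq_zero]
  · simp only [orthonormalGenerator, Matrix.smul_mul, Matrix.mul_smul, Matrix.trace_smul,
      smul_eq_mul, h.trace_mul, ← mul_assoc, h2, Option.some.injEq]
    split_ifs <;> simp

/-- Orthonormality says that the matrix with the basis operators as rows is a coisometry. It is
square, since `1 + (d² - 1) = d²`, hence unitary, and its columns are orthonormal too. -/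
theorem orthonormalGenerator_completeness {d : ℕ} (hd : d ≠ 0)
    {lam : Fin (d ^ 2 - 1) → Matrix (Fin d) (Fin d) ℂ} (h : IsSUGenerators lam)
    (x y x' y' : Fin d) :
    ∑ o, orthonormalGenerator lam o x y * star (orthonormalGenerator lam o x' y')
      = (if x = x' then 1 else 0) * (if y = y' then 1 else 0) := by
  let U : Matrix (Option (Fin (d ^ 2 - 1))) (Fin d × Fin d) ℂ :=
    Matrix.of fun o q => orthonormalGenerator lam o q.1 q.2
  have hU : U * Uᴴ = 1 := by
    ext o o'
    rw [Matrix.one_apply, ← orthonormalGenerator_trace_mul hd h]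
    simp only [Matrix.mul_apply, Matrix.trace, Matrix.diag, Fintype.sum_prod_type,
      Matrix.conjTranspose_apply, U, Matrix.of_apply]
    refine Finset.sum_congr rfl fun x _ => Finset.sum_congr rfl fun y _ => ?_
    rw [(orthonormalGenerator_isHermitian h o').apply]
  have hcard : Fintype.card (Option (Fin (d ^ 2 - 1))) = Fintype.card (Fin d × Fin d) := by
    have : 0 < d ^ 2 := by positivity
    simp only [Fintype.card_option, Fintype.card_fin, Fintype.card_prod]
    rw [← sq]; omega
  have hU' := (Matrix.mul_eq_one_comm_of_card_eq _ _ _ hcard).1 hU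
  have := congrFun (congrFun hU' (x', y')) (x, y)
  simp only [Matrix.mul_apply, Matrix.conjTranspose_apply, U, Matrix.of_apply, Matrix.one_apply,
    Prod.mk.injEq] at this
  simp only [mul_comm (star _)] at this
  rw [this]
  by_cases hx : x = x' <;> by_cases hy : y = y' <;> 
    simp [hx, hy, eq_comm (a := x'), eq_comm (a := y')]

/-! ### Weights of coefficients and reduced purities -/

/-- The coefficient of `|ψ⟩⟨ψ|` along `⨂ᵢ g_{oᵢ}`. -/
def pureCoeff {n : ℕ} {d : Fin n → ℕ}
    (lam : (i : Fin n) → Fin (d i ^ 2 - 1) → Matrix (Fin (d i)) (Fin (d i)) ℂ)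
    (ψ : TensorIndex d → ℂ) (o : (i : Fin n) → Option (Fin (d i ^ 2 - 1))) : ℂ :=
  ∑ x, ∑ y, ψ x * star (ψ y) * ∏ i, orthonormalGenerator (lam i) (o i) (y i) (x i)

/-- The purity of the reduction of `|ψ⟩⟨ψ|` to the sites in `S`. -/
def reducedPurity {n : ℕ} {d : Fin n → ℕ} (ψ : TensorIndex d → ℂ) (S : Finset (Fin n)) : ℂ :=
  ∑ x, ∑ y, ψ x * ψ y * star (ψ (S.piecewise x y)) * star (ψ (S.piecewise y x))

/-- Complementing `S` only exchanges the two mixed indices. This is the equality of the purities of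
the two halves of a pure state. -/
theorem reducedPurity_compl {n : ℕ} {d : Fin n → ℕ} (ψ : TensorIndex d → ℂ)
    (S : Finset (Fin n)) : reducedPurity ψ Sᶜ = reducedPurity ψ S := by
  refine Finset.sum_congr rfl fun x _ => Finset.sum_congr rfl fun y _ => ?_
  rw [Finset.piecewise_compl, Finset.piecewise_compl]
  ring

theorem reducedPurity_empty {n : ℕ} {d : Fin n → ℕ} {ψ : TensorIndex d → ℂ}
    (hψ : ∑ x, ‖ψ x‖ ^ 2 = 1) : reducedPurity ψ ∅ = 1 := by
  have h : ∑ x, ψ x * star (ψ x) = 1 := by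
    rw [← Complex.ofReal_one, ← hψ]
    push_cast
    exact Finset.sum_congr rfl fun x _ => Complex.mul_conj' _
  simp only [reducedPurity, Finset.piecewise_empty]
  calc _ = (∑ x, ψ x * star (ψ x)) * ∑ x, ψ x * star (ψ x) := by
        rw [Finset.sum_mul_sum]
        refine Finset.sum_congr rfl fun x _ => Finset.sum_congr rfl fun y _ => ?_
        ring
    _ = 1 := by rw [h, one_mul]

/-- The total weight of the coefficients that are trivial on the sites in `S`. -/
def trivialWeight {n : ℕ} {d : Fin n → ℕ}
    (lam : (i : Fin n) → Fin (d i ^ 2 - 1) → Matrix (Fin (d i)) (Fin (d i)) ℂ)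
    (ψ : TensorIndex d → ℂ) (S : Finset (Fin n)) : ℝ :=
  ∑ o, if ∀ i ∈ S, o i = none then ‖pureCoeff lam ψ o‖ ^ 2 else 0

/-- Over a box of labels the sum of products becomes a product of one-site kernels, each of which
can then be evaluated separately. -/
theorem sum_piFinset_normSq_pureCoeff {n : ℕ} {d : Fin n → ℕ}
    (lam : (i : Fin n) → Fin (d i ^ 2 - 1) → Matrix (Fin (d i)) (Fin (d i)) ℂ)
    (ψ : TensorIndex d → ℂ) (T : (i : Fin n) → Finset (Option (Fin (d i ^ 2 - 1)))) :
    ((∑ o ∈ Fintype.piFinset T, ‖pureCoeff lam ψ o‖ ^ 2 : ℝ) : ℂ) =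
      ∑ x, ∑ z, ∑ y, ∑ x', ψ x * star (ψ y) * star (ψ x') * ψ z *
        ∏ i, ∑ o ∈ T i, orthonormalGenerator (lam i) o (y i) (x i) *
          star (orthonormalGenerator (lam i) o (z i) (x' i)) := by
  have h : ∀ o, ((‖pureCoeff lam ψ o‖ ^ 2 : ℝ) : ℂ) =
      ∑ x, ∑ z, ∑ y, ∑ x', ψ x * star (ψ y) * star (ψ x') * ψ z *
        ∏ i, orthonormalGenerator (lam i) (o i) (y i) (x i) *
          star (orthonormalGenerator (lam i) (o i) (z i) (x' i)) := by
    intro o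
    have : ((‖pureCoeff lam ψ o‖ ^ 2 : ℝ) : ℂ) = pureCoeff lam ψ o * star (pureCoeff lam ψ o) := by
      rw [Complex.ofReal_pow]; exact (Complex.mul_conj' _).symm
    rw [this]
    simp only [pureCoeff, star_sum, star_mul', star_star, star_prod]
    conv_lhs => enter [2]; rw [Finset.sum_comm]
    rw [Finset.sum_mul_sum]
    refine Finset.sum_congr rfl fun x _ => Finset.sum_congr rfl fun z _ => ?_
    rw [Finset.sum_mul_sum]
    refine Finset.sum_congr rfl fun y _ => Finset.sum_congr rfl fun x' _ => ?_
    rw [Finset.prod_mul_distrib]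
    ring
  push_cast at h ⊢
  simp only [h, Finset.prod_univ_sum, Finset.mul_sum]
  rw [Finset.sum_comm]
  refine Finset.sum_congr rfl fun x _ => ?_
  rw [Finset.sum_comm]
  refine Finset.sum_congr rfl fun x _ => ?_
  rw [Finset.sum_comm]
  refine Finset.sum_congr rfl fun x _ => ?_
  rw [Finset.sum_comm]

theorem trivialWeight_eq {n : ℕ} {d : Fin n → ℕ} (hd : ∀ i, d i ≠ 0)
    {lam : (i : Fin n) → Fin (d i ^ 2 - 1) → Matrix (Fin (d i)) (Fin (d i)) ℂ}
    (h : ∀ i, IsSUGenerators (lam i)) (ψ : TensorIndex d → ℂ) (S : Finset (Fin n)) :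
    (trivialWeight lam ψ S : ℂ) = (∏ i ∈ S, (d i : ℂ))⁻¹ * reducedPurity ψ S := by
  let T : (i : Fin n) → Finset (Option (Fin (d i ^ 2 - 1))) :=
    fun i => if i ∈ S then {none} else Finset.univ
  have hT : trivialWeight lam ψ S = ∑ o ∈ Fintype.piFinset T, ‖pureCoeff lam ψ o‖ ^ 2 := by
    rw [trivialWeight, ← Finset.sum_filter]
    refine Finset.sum_congr ?_ fun _ _ => rfl
    ext o
    simp only [Finset.mem_filter, Finset.mem_univ, true_and, Fintype.mem_piFinset, T]
    refine forall_congr' fun i => ?_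
    by_cases hi : i ∈ S <;> simp [hi]
  rw [hT, sum_piFinset_normSq_pureCoeff, reducedPurity, Finset.mul_sum]
  refine Finset.sum_congr rfl fun x _ => ?_
  rw [Finset.mul_sum]
  refine Finset.sum_congr rfl fun z _ => ?_
  have key : ∀ y x' : TensorIndex d,
      ∏ i, ∑ o ∈ T i, orthonormalGenerator (lam i) o (y i) (x i) *
          star (orthonormalGenerator (lam i) o (z i) (x' i)) =
        if x' = S.piecewise z x then
          (if y = S.piecewise x z then (∏ i ∈ S, (d i : ℂ))⁻¹ else 0) else 0 := by
    intro y x'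
    -- A site in `S` keeps only the identity, which forces `y = x` and `x' = z` there with factor
    -- `1/dᵢ`. At any other site completeness forces `y = z` and `x' = x`.
    have hK : ∀ i, ∑ o ∈ T i, orthonormalGenerator (lam i) o (y i) (x i) *
          star (orthonormalGenerator (lam i) o (z i) (x' i)) =
        (if i ∈ S then (d i : ℂ)⁻¹ else 1) *
          (if x' i = S.piecewise z x i then (if y i = S.piecewise x z i then 1 else 0) else 0) := by
      intro i
      by_cases hi : i ∈ S
      · have h1 := ofReal_inv_sqrt_mul_self (r := (d i : ℝ)) (by positivity)
        simp only [T, hi, if_true, Finset.sum_singleton, Finset.piecewise_eq_of_mem,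
          orthonormalGenerator, Matrix.smul_apply, smul_eq_mul, Matrix.one_apply]
        by_cases e1 : y i = x i <;> by_cases e2 : x' i = z i
        · simp only [e1, e2, if_true, mul_one, Complex.star_def, map_inv₀, Complex.conj_ofReal]
          simpa using h1
        · simp [e1, e2, Ne.symm e2]
        · simp [e1, e2]
        · simp [e1, e2]
      · simp only [T, hi, if_false, orthonormalGenerator_completeness (hd i) (h i), one_mul,
          Finset.piecewise_eq_of_notMem _ _ _ hi]
        by_cases e1 : y i = z i <;> by_cases e2 : x i = x' i <;> simp [e1, e2, eq_comm]
    simp only [hK, Finset.prod_mul_distrib]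
    rw [Finset.prod_ite_mem, Finset.univ_inter, Finset.prod_inv_distrib]
    simp only [funext_iff (f := x'), funext_iff (f := y)]
    by_cases e2 : ∀ i, x' i = S.piecewise z x i
    · by_cases e1 : ∀ i, y i = S.piecewise x z i
      · simp [e1, e2]
      · rw [if_pos e2, if_neg e1]
        push Not at e1
        obtain ⟨i, hi⟩ := e1
        rw [Finset.prod_eq_zero (Finset.mem_univ i), mul_zero]
        simp [hi]
    · rw [if_neg e2]
      push Not at e2
      obtain ⟨i, hi⟩ := e2
      rw [Finset.prod_eq_zero (Finset.mem_univ i), mul_zero]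
      simp [hi]
  simp only [key, mul_ite, mul_zero, Finset.sum_ite_eq', Finset.mem_univ, if_true]
  ring

/-! ### The counting inequality -/

/-- The cases are the possible numbers of identity labels. There is equality for `0`, `n - 2`, `n -
1` and `n` of them; in between, the count is below `n - 2`. -/
theorem sum_ite_eq_none_le {n : ℕ} (hn : 2 ≤ n) {α : Fin n → Type*} (o : (i : Fin n) → Option (α i)) :
    (∑ i, if o i = none then (1 : ℝ) else 0) ≤
      ((n : ℝ) - 2) * (1 - if ∀ i, o i ≠ none then 1 else 0)
        + (∑ i, if ∀ j, j ≠ i → o j = none then (1 : ℝ) else 0)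
        - ((n : ℝ) - 2) * if ∀ i, o i = none then 1 else 0 := by
  have hn' : (2 : ℝ) ≤ n := by exact_mod_cast hn
  set s : Finset (Fin n) := Finset.univ.filter fun i => o i = none with hs
  have hmem : ∀ i, i ∈ s ↔ o i = none := by simp [hs]
  have hsum : (∑ i, if o i = none then (1 : ℝ) else 0) = s.card := by
    simp [hs, Finset.sum_boole]
  have hpos : ∀ i, (0 : ℝ) ≤ if ∀ j, j ≠ i → o j = none then (1 : ℝ) else 0 := fun i => by
    split_ifs <;> norm_num
  have hpos' := Finset.sum_nonneg fun i (_ : i ∈ Finset.univ) => hpos i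
  rw [hsum]
  by_cases hall : ∀ i, o i = none
  · have h1 : ¬ ∀ i, o i ≠ none := fun h => h ⟨0, by omega⟩ (hall _)
    have h2 : (s.card : ℝ) ≤ n := by
      exact_mod_cast (Finset.card_le_univ s).trans_eq (Fintype.card_fin n)
    have h3 : (∑ i, if ∀ j, j ≠ i → o j = none then (1 : ℝ) else 0) = n := by simp [hall]
    rw [if_neg h1, if_pos hall, h3]
    linarith
  by_cases hnone : ∀ i, o i ≠ none
  · have h2 : s = ∅ := by ext i; simp [hmem, hnone]
    rw [if_pos hnone, if_neg hall, h2]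
    simp only [Finset.card_empty, Nat.cast_zero]
    linarith
  rw [if_neg hnone, if_neg hall]
  by_cases hone : ∃ i, ∀ j, j ≠ i → o j = none
  · obtain ⟨i, hi⟩ := hone
    have h3 := Finset.single_le_sum (fun i _ => hpos i) (Finset.mem_univ i)
    rw [if_pos hi] at h3
    have h4 : (s.card : ℝ) ≤ n - 1 := by
      have : s.card < n := by
        refine lt_of_le_of_ne ((Finset.card_le_univ s).trans_eq (Fintype.card_fin n)) fun h => ?_
        exact hall fun j => (hmem j).1
          (by rw [(Finset.card_eq_iff_eq_univ s).1 (by simpa using h)]; exact Finset.mem_univ j)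
      have : s.card + 1 ≤ n := this
      have : (s.card : ℝ) + 1 ≤ n := by exact_mod_cast this
      linarith
    linarith
  · have h4 : (s.card : ℝ) ≤ n - 2 := by
      push Not at hall hone
      obtain ⟨i, hi⟩ := hall
      obtain ⟨j, hji, hj⟩ := hone i
      have h5 : s ⊆ Finset.univ \ {i, j} := by
        intro l hl
        simp only [Finset.mem_sdiff, Finset.mem_univ, true_and, Finset.mem_insert,
          Finset.mem_singleton, not_or]
        exact ⟨fun h => hi ((hmem i).1 (h ▸ hl)), fun h => hj ((hmem j).1 (h ▸ hl))⟩
      have h6 := Finset.card_le_card h5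
      rw [Finset.card_sdiff_of_subset (Finset.subset_univ _), Finset.card_pair (Ne.symm hji),
        Finset.card_univ, Fintype.card_fin] at h6
      have : s.card + 2 ≤ n := by omega
      have : (s.card : ℝ) + 2 ≤ n := by exact_mod_cast this
      linarith
    linarith

/-! ### Weight relations for a pure state -/

section
variable {n : ℕ} {d : Fin n → ℕ}
  {lam : (i : Fin n) → Fin (d i ^ 2 - 1) → Matrix (Fin (d i)) (Fin (d i)) ℂ}
  {ψ : TensorIndex d → ℂ}

theorem blochEntry_vecMulVec (a : (i : Fin n) → Fin (d i ^ 2 - 1)) :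
    blochEntry lam (Matrix.vecMulVec ψ (star ψ)) a =
      ∑ x, ∑ y, ψ x * star (ψ y) * ∏ i, lam i (a i) (y i) (x i) := by
  simp [blochEntry, Matrix.trace, Matrix.mul_apply, tensorMatrix, Matrix.vecMulVec_apply]

theorem normSq_pureCoeff_some (a : (i : Fin n) → Fin (d i ^ 2 - 1)) :
    ‖pureCoeff lam ψ fun i => some (a i)‖ ^ 2 =
      (2 ^ n)⁻¹ * ‖blochEntry lam (Matrix.vecMulVec ψ (star ψ)) a‖ ^ 2 := by
  have h : (pureCoeff lam ψ fun i => some (a i)) =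
      ((√(2 : ℝ))⁻¹ : ℂ) ^ n * blochEntry lam (Matrix.vecMulVec ψ (star ψ)) a := by
    rw [blochEntry_vecMulVec, pureCoeff]
    simp only [Finset.mul_sum, orthonormalGenerator, Matrix.smul_apply, smul_eq_mul,
      Finset.prod_mul_distrib, Finset.prod_const, Finset.card_univ, Fintype.card_fin]
    refine Finset.sum_congr rfl fun x _ => Finset.sum_congr rfl fun y _ => ?_
    ring
  rw [h, norm_mul, mul_pow, norm_pow, norm_inv, Complex.norm_real, ← pow_mul, mul_comm n 2,
    pow_mul, inv_pow, Real.norm_eq_abs, sq_abs, Real.sq_sqrt (by norm_num), inv_pow]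

theorem sum_nontrivial_normSq_pureCoeff :
    (∑ o, if ∀ i, o i ≠ none then ‖pureCoeff lam ψ o‖ ^ 2 else 0) =
      (2 ^ n)⁻¹ * blochNormSq lam (Matrix.vecMulVec ψ (star ψ)) := by
  rw [blochNormSq, Finset.mul_sum]
  symm
  refine Finset.sum_of_injOn (fun a i => some (a i)) ?_ ?_ ?_ ?_
  · intro a _ b _ hab
    funext i
    exact Option.some.inj (congrFun hab i)
  · simp
  · intro o _ ho
    rw [if_neg]
    intro h
    refine ho ⟨fun i => (o i).get (Option.isSome_iff_ne_none.2 (h i)), by simp, ?_⟩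
    simp
  · intro a _
    rw [if_pos (by simp), normSq_pureCoeff_some]

theorem trivialWeight_anti {S T : Finset (Fin n)} (hST : S ⊆ T) :
    trivialWeight lam ψ T ≤ trivialWeight lam ψ S := by
  refine Finset.sum_le_sum fun o _ => ?_
  by_cases hT : ∀ i ∈ T, o i = none
  · rw [if_pos hT, if_pos fun i hi => hT i (hST hi)]
  · rw [if_neg hT]
    split_ifs <;> positivity

theorem trivialWeight_empty (hd : ∀ i, d i ≠ 0) (h : ∀ i, IsSUGenerators (lam i))
    (hψ : ∑ x, ‖ψ x‖ ^ 2 = 1) : trivialWeight lam ψ ∅ = 1 := by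
  have := trivialWeight_eq hd h ψ ∅
  rw [reducedPurity_empty hψ] at this
  simpa using this

theorem trivialWeight_univ (hd : ∀ i, d i ≠ 0) (h : ∀ i, IsSUGenerators (lam i))
    (hψ : ∑ x, ‖ψ x‖ ^ 2 = 1) : trivialWeight lam ψ Finset.univ = (∏ i, (d i : ℝ))⁻¹ := by
  have := trivialWeight_eq hd h ψ Finset.univ
  -- By complementation, the purity of the whole system is that of the empty one.
  rw [← Finset.compl_empty, reducedPurity_compl, reducedPurity_empty hψ, mul_one,
    Finset.compl_empty] at this
  apply Complex.ofReal_injective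
  rw [this]
  push_cast
  rfl

theorem trivialWeight_compl (hd : ∀ i, d i ≠ 0) (h : ∀ i, IsSUGenerators (lam i))
    (S : Finset (Fin n)) :
    (∏ i ∈ Sᶜ, (d i : ℝ)) * trivialWeight lam ψ Sᶜ = (∏ i ∈ S, (d i : ℝ)) * trivialWeight lam ψ S := by
  have h1 : ∀ S : Finset (Fin n), (∏ i ∈ S, (d i : ℂ)) * trivialWeight lam ψ S
      = reducedPurity ψ S := by
    intro S
    rw [trivialWeight_eq hd h ψ S, mul_inv_cancel_left₀]
    exact Finset.prod_ne_zero_iff.2 fun i _ => by exact_mod_cast hd i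
  have h2 := (h1 Sᶜ).trans ((reducedPurity_compl ψ S).trans (h1 S).symm)
  exact_mod_cast h2

/-- With `p` the purity of the reduction to site `i`, the weight trivial at `i` is `p / dᵢ`, the
weight trivial away from `i` is `p dᵢ / ∏ d`, and `p ≥ 1 / dᵢ`. -/
theorem exists_sitePurity (hd : ∀ i, d i ≠ 0) (h : ∀ i, IsSUGenerators (lam i))
    (hψ : ∑ x, ‖ψ x‖ ^ 2 = 1) (i : Fin n) :
    ∃ p : ℝ, 1 / (d i : ℝ) ≤ p ∧ trivialWeight lam ψ {i} = p / d i ∧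
      trivialWeight lam ψ {i}ᶜ = p * d i / ∏ j, (d j : ℝ) := by
  have hdi : (0 : ℝ) < d i := by exact_mod_cast Nat.pos_of_ne_zero (hd i)
  have hD : (0 : ℝ) < ∏ j, (d j : ℝ) :=
    Finset.prod_pos fun j _ => by exact_mod_cast Nat.pos_of_ne_zero (hd j)
  have hsplit : (d i : ℝ) * ∏ j ∈ {i}ᶜ, (d j : ℝ) = ∏ j, (d j : ℝ) := by
    rw [← Finset.prod_mul_prod_compl {i}, Finset.prod_singleton]
  have h1 := trivialWeight_compl (ψ := ψ) hd h {i}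
  rw [Finset.prod_singleton] at h1
  have h2 : trivialWeight lam ψ {i}ᶜ = d i * trivialWeight lam ψ {i} * d i / ∏ j, (d j : ℝ) := by
    rw [eq_div_iff hD.ne', ← h1, ← hsplit]
    ring
  refine ⟨d i * trivialWeight lam ψ {i}, ?_, by field_simp, h2⟩
  -- The bound `p ≥ 1/dᵢ` needs no spectral argument: the weight trivial away from `i` contains the
  -- all-identity term, of weight `1/∏ d`.
  have h3 := trivialWeight_anti (lam := lam) (ψ := ψ) (Finset.subset_univ {i}ᶜ)
  rw [trivialWeight_univ hd h hψ, h2, inv_eq_one_div, div_le_div_iff_of_pos_right hD] at h3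
  rwa [div_le_iff₀ hdi]

/-- The counting inequality, weighted by the squared coefficient of each label and summed over all
labels. -/
theorem sum_trivialWeight_le (hn : 2 ≤ n) (hd : ∀ i, d i ≠ 0) (h : ∀ i, IsSUGenerators (lam i))
    (hψ : ∑ x, ‖ψ x‖ ^ 2 = 1) :
    ∑ i, trivialWeight lam ψ {i} ≤
      ((n : ℝ) - 2) * (1 - (2 ^ n)⁻¹ * blochNormSq lam (Matrix.vecMulVec ψ (star ψ)))
        + ∑ i, trivialWeight lam ψ {i}ᶜ - ((n : ℝ) - 2) * trivialWeight lam ψ Finset.univ := by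
  classical
  rw [← trivialWeight_empty hd h hψ, ← sum_nontrivial_normSq_pureCoeff]
  simp only [trivialWeight, Finset.notMem_empty, false_imp_iff, implies_true, if_true]
  rw [Finset.sum_comm, Finset.sum_comm (s := Finset.univ) (t := Finset.univ)
    (f := fun i o => if ∀ j ∈ ({i}ᶜ : Finset (Fin n)), o j = none then
      ‖pureCoeff lam ψ o‖ ^ 2 else 0), ← Finset.sum_sub_distrib, Finset.mul_sum, Finset.mul_sum,
    ← Finset.sum_add_distrib, ← Finset.sum_sub_distrib]
  refine Finset.sum_le_sum fun o _ => ?_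
  have h1 := mul_le_mul_of_nonneg_left (sum_ite_eq_none_le hn o) (sq_nonneg ‖pureCoeff lam ψ o‖)
  simp only [Finset.mem_singleton, forall_eq, Finset.mem_compl, Finset.mem_univ, true_imp_iff]
  calc _ = _ := ?_
    _ ≤ _ := h1
    _ = _ := ?_
  · rw [Finset.mul_sum]
    exact Finset.sum_congr rfl fun i _ => by split_ifs <;> simp
  · rw [mul_sub, mul_add, Finset.mul_sum]
    congr 1
    · congr 1
      · split_ifs <;> ring
      · exact Finset.sum_congr rfl fun i _ => by split_ifs <;> simp
    · split_ifs <;> ring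

theorem nontrivial_add_trivialWeight_of_one {d : Fin 1 → ℕ}
    {lam : (i : Fin 1) → Fin (d i ^ 2 - 1) → Matrix (Fin (d i)) (Fin (d i)) ℂ}
    {ψ : TensorIndex d → ℂ} (hd : ∀ i, d i ≠ 0) (h : ∀ i, IsSUGenerators (lam i))
    (hψ : ∑ x, ‖ψ x‖ ^ 2 = 1) :
    (2 ^ 1)⁻¹ * blochNormSq lam (Matrix.vecMulVec ψ (star ψ)) +
      trivialWeight lam ψ Finset.univ = 1 := by
  rw [← trivialWeight_empty hd h hψ, ← sum_nontrivial_normSq_pureCoeff]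
  simp only [trivialWeight, ← Finset.sum_add_distrib]
  refine Finset.sum_congr rfl fun o _ => ?_
  by_cases h0 : o 0 = none <;> simp [Fin.forall_fin_one, h0]

theorem nontrivial_add_trivialWeight_of_two {d : Fin 2 → ℕ}
    {lam : (i : Fin 2) → Fin (d i ^ 2 - 1) → Matrix (Fin (d i)) (Fin (d i)) ℂ}
    {ψ : TensorIndex d → ℂ} (hd : ∀ i, d i ≠ 0) (h : ∀ i, IsSUGenerators (lam i))
    (hψ : ∑ x, ‖ψ x‖ ^ 2 = 1) :
    (2 ^ 2)⁻¹ * blochNormSq lam (Matrix.vecMulVec ψ (star ψ)) + trivialWeight lam ψ {0} +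
      trivialWeight lam ψ {0}ᶜ = 1 + trivialWeight lam ψ Finset.univ := by
  rw [← trivialWeight_empty hd h hψ, ← sum_nontrivial_normSq_pureCoeff]
  simp only [trivialWeight, ← Finset.sum_add_distrib]
  refine Finset.sum_congr rfl fun o _ => ?_
  by_cases h0 : o 0 = none <;> by_cases h1 : o 1 = none <;> simp [Fin.forall_fin_two, h0, h1]
end

/-! ### The bound for one block -/

/-- The subsets that miss exactly one index are the complements of singletons. -/
theorem sum_powersetCard_prod_eq_sum_div {t : ℕ} (e : Fin (t + 1) → ℝ) (he : ∀ i, e i ≠ 0) :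
    ∑ s ∈ Finset.univ.powersetCard t, ∏ i ∈ s, e i = ∑ i, (∏ j, e j) / e i := by
  symm
  refine Finset.sum_nbij (fun i => {i}ᶜ) ?_ ?_ ?_ ?_
  · intro i _
    simp [Finset.mem_powersetCard, Finset.card_compl]
  · intro i _ j _ hij
    simpa using hij
  · intro s hs
    have hs' := (Finset.mem_powersetCard.1 hs).2
    have : sᶜ.card = 1 := by rw [Finset.card_compl, hs', Fintype.card_fin]; omega
    obtain ⟨i, hi⟩ := Finset.card_eq_one.1 this
    exact ⟨i, by simp, by simp [← hi]⟩
  · intro i _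
    rw [← Finset.prod_mul_prod_compl {i}, Finset.prod_singleton, mul_div_cancel_left₀ _ (he i)]

/-- The full Bloch tensor of a pure state on sites of increasing dimensions. -/
theorem blochNormSq_pure_le_blockBound : ∀ {t : ℕ}, 1 ≤ t → ∀ {e : Fin t → ℕ}, (∀ i, 2 ≤ e i) →
    Monotone e → DimCondition t e →
    ∀ {lam : (i : Fin t) → Fin (e i ^ 2 - 1) → Matrix (Fin (e i)) (Fin (e i)) ℂ},
    (∀ i, IsSUGenerators (lam i)) → ∀ {ψ : TensorIndex e → ℂ}, ∑ x, ‖ψ x‖ ^ 2 = 1 →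
    blochNormSq lam (Matrix.vecMulVec ψ (star ψ)) ≤ blockBound t e
  | 1, _, e, he, _, _, lam, h, ψ, hψ => by
    have hd : ∀ i, e i ≠ 0 := fun i => by have := he i; omega
    have h0 : (0 : ℝ) < e 0 := by exact_mod_cast Nat.pos_of_ne_zero (hd 0)
    have h1 := nontrivial_add_trivialWeight_of_one hd h hψ
    rw [trivialWeight_univ hd h hψ] at h1
    simp only [Finset.univ_unique, Fin.default_eq_zero, Finset.prod_singleton] at h1
    refine le_of_eq ?_
    have : blockBound 1 e = 2 * ((e 0 : ℝ) - 1) / e 0 := rfl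
    rw [this]
    field_simp at h1 ⊢
    linarith
  | 2, _, e, he, hmono, _, lam, h, ψ, hψ => by
    have hd : ∀ i, e i ≠ 0 := fun i => by have := he i; omega
    have h0 : (0 : ℝ) < e 0 := by exact_mod_cast Nat.pos_of_ne_zero (hd 0)
    have h0' : (0 : ℝ) < e 1 := by exact_mod_cast Nat.pos_of_ne_zero (hd 1)
    have h1 := nontrivial_add_trivialWeight_of_two hd h hψ
    obtain ⟨p, hp, hp1, hp2⟩ := exists_sitePurity hd h hψ 0
    rw [trivialWeight_univ hd h hψ, hp1, hp2, Fin.prod_univ_two] at h1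
    -- After inserting `p ≥ 1/e₀` in both terms, `p/e₁` absorbs the all-identity weight `1/(e₀e₁)`,
    -- and `1 - 1/e₀²` remains.
    have h2 : p * e 0 / (e 0 * e 1) = p / (e 1 : ℝ) := by field_simp
    rw [h2] at h1
    have h3 : 1 / (e 0 : ℝ) / e 0 ≤ p / e 0 := by gcongr
    have h4 : 1 / (e 0 : ℝ) / e 1 ≤ p / e 1 := by gcongr
    have : blockBound 2 e = 2 ^ 2 * ((e 0 : ℝ) ^ 2 - 1) / (e 0 : ℝ) ^ 2 := rfl
    rw [this]
    have h5 : 2 ^ 2 * ((e 0 : ℝ) ^ 2 - 1) / (e 0 : ℝ) ^ 2 = 2 ^ 2 * (1 - 1 / (e 0 : ℝ) / e 0) := by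
      field_simp
    have h6 : ((e 0 : ℝ) * e 1)⁻¹ = 1 / (e 0 : ℝ) / e 1 := by field_simp
    rw [h5]
    linarith
  | t + 3, _, e, he, hmono, hdim, lam, h, ψ, hψ => by
    have hd : ∀ i, e i ≠ 0 := fun i => by have := he i; omega
    have hpos : ∀ i, (0 : ℝ) < e i := fun i => by exact_mod_cast Nat.pos_of_ne_zero (hd i)
    have hD : (0 : ℝ) < ∏ j, (e j : ℝ) := Finset.prod_pos fun j _ => hpos j
    set D : ℝ := ∏ j, (e j : ℝ) with hDdef
    set l := Fin.last (t + 2) with hl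
    have hle : ∀ i, (e i : ℝ) ≤ e l := fun i => by exact_mod_cast hmono (Fin.le_last i)
    have hDl : D = (∏ i : Fin (t + 2), (e i.castSucc : ℝ)) * e l := Fin.prod_univ_castSucc _
    -- The only use of the dimension condition: it keeps the coefficient `1/eᵢ - eᵢ/D` of the purity
    -- nonnegative.
    have hsq : ∀ i, (e i : ℝ) * e i ≤ D := by
      intro i
      have h1 : (e l : ℝ) ≤ ∏ i : Fin (t + 2), (e i.castSucc : ℝ) := by
        have h2 : e l ≤ ∏ i : Fin (t + 2), e i.castSucc := hdim
        exact_mod_cast h2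
      rw [hDl]
      exact mul_le_mul ((hle i).trans h1) (hle i) (hpos i).le ((hpos l).le.trans h1)
    have hsum := sum_trivialWeight_le (by omega) hd h hψ
    rw [trivialWeight_univ hd h hψ] at hsum
    set F := (2 ^ (t + 3))⁻¹ * blochNormSq lam (Matrix.vecMulVec ψ (star ψ)) with hF
    -- The purity bound alone gives `1/eᵢ² - 1/D`. The extra factor `eᵢ/e_l ≤ 1` weakens this to the
    -- common denominator `D e_l` of the stated constant.
    have hsite : ∀ i, ((e i : ℝ) ^ 2 / D)⁻¹ / D * (e i / e l) - e i / D / e l ≤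
        trivialWeight lam ψ {i} - trivialWeight lam ψ {i}ᶜ := by
      intro i
      obtain ⟨p, hp, hp1, hp2⟩ := exists_sitePurity hd h hψ i
      rw [hp1, hp2]
      have hi := hpos i
      have hli := hpos l
      have hcoef : 0 ≤ 1 / (e i : ℝ) - e i / D := by
        rw [sub_nonneg, div_le_div_iff₀ hD hi]
        linarith [hsq i]
      calc _ = (1 / (e i : ℝ)) * (1 / (e i : ℝ) - e i / D) * (e i / e l) := by field_simp
        _ ≤ (1 / (e i : ℝ)) * (1 / (e i : ℝ) - e i / D) * 1 := by
          gcongr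
          exact (div_le_one hli).2 (hle i)
        _ ≤ p * (1 / (e i : ℝ) - e i / D) := by
          rw [mul_one]
          gcongr
        _ = _ := by ring
    have hall := Finset.sum_le_sum fun i (_ : i ∈ Finset.univ) => hsite i
    rw [Finset.sum_sub_distrib, Finset.sum_sub_distrib] at hall
    have hbound : blockBound (t + 3) e = 2 ^ (t + 3) *
        (1 - ((∑ s ∈ Finset.univ.powersetCard (t + 2), ∏ i ∈ s, (e i : ℝ))
          - ∑ i, (e i : ℝ) + ((t : ℝ) + 1) * (e l : ℝ)) /
            (((t : ℝ) + 1) * (∏ i : Fin (t + 2), (e i.castSucc : ℝ)) * (e l : ℝ) ^ 2)) := rfl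
    have hden : ((t : ℝ) + 1) * (∏ i : Fin (t + 2), (e i.castSucc : ℝ)) * (e l : ℝ) ^ 2 =
        ((t : ℝ) + 1) * D * e l := by
      rw [hDl]
      ring
    have hblo : blochNormSq lam (Matrix.vecMulVec ψ (star ψ)) = 2 ^ (t + 3) * F := by
      rw [hF, mul_inv_cancel_left₀ (by positivity)]
    rw [hbound, hblo, sum_powersetCard_prod_eq_sum_div _ fun i => (hpos i).ne', ← hDdef,
      hden]
    gcongr
    have ht1 : (0 : ℝ) < (t : ℝ) + 1 := by positivity
    have hli := hpos l
    have e1 : ∑ i, ((e i : ℝ) ^ 2 / D)⁻¹ / D * (e i / e l) = (∑ i, D / e i) / (D * e l) := by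
      rw [Finset.sum_div]
      refine Finset.sum_congr rfl fun i _ => ?_
      have := hpos i
      field_simp
    have e2 : ∑ i, (e i : ℝ) / D / e l = (∑ i, (e i : ℝ)) / (D * e l) := by
      rw [Finset.sum_div]
      refine Finset.sum_congr rfl fun i _ => ?_
      rw [div_div]
    rw [e1, e2] at hall
    have e3 : ((∑ i, D / (e i : ℝ)) - ∑ i, (e i : ℝ) + ((t : ℝ) + 1) * e l) /
        (((t : ℝ) + 1) * D * e l) = ((∑ i, D / (e i : ℝ)) / (D * e l)
          - (∑ i, (e i : ℝ)) / (D * e l) + ((t : ℝ) + 1) * D⁻¹) / ((t : ℝ) + 1) := by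
      field_simp
    rw [e3, le_sub_iff_add_le, ← le_sub_iff_add_le', div_le_iff₀ ht1]
    push_cast at hsum
    linarith

/-! ### Factorization over the blocks of an arrangement -/

namespace Arrangement
variable {m n : ℕ} {k : Fin m → ℕ} (A : Arrangement k n)

theorem prod_site {M : Type*} [CommMonoid M] (f : Fin n → M) :
    ∏ i, f i = ∏ j, ∏ a, f (A.site ⟨j, a⟩) := by
  rw [← A.site.prod_comp, Fintype.prod_sigma]

theorem sum_prod_block {R : Type*} [CommSemiring R] {γ : Fin n → Type*} [∀ i, Fintype (γ i)]
    (F : (j : Fin m) → ((a : Fin (k j)) → γ (A.site ⟨j, a⟩)) → R) :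
    ∑ x : (i : Fin n) → γ i, ∏ j, F j (fun a => x (A.site ⟨j, a⟩)) = ∏ j, ∑ y, F j y := by
  classical
  rw [Finset.prod_univ_sum, Fintype.piFinset_univ]
  -- Reindexing along `A.site` and currying identifies a global index with a family of block
  -- indices.
  refine Fintype.sum_equiv ((Equiv.piCongrLeft γ A.site).symm.trans
    (Equiv.piCurry fun j a => γ (A.site ⟨j, a⟩))) _ _ fun x => ?_
  rfl

variable {d : Fin n → ℕ}

theorem blochEntry_productVector
    (lam : (i : Fin n) → Fin (d i ^ 2 - 1) → Matrix (Fin (d i)) (Fin (d i)) ℂ)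
    (φ : (j : Fin m) → EuclideanSpace ℂ (TensorIndex (A.blockDims d j)))
    (a : (i : Fin n) → Fin (d i ^ 2 - 1)) :
    blochEntry lam (Matrix.vecMulVec (A.productVector d φ) (star (A.productVector d φ))) a =
      ∏ j, blochEntry (d := A.blockDims d j) (fun b => lam (A.site ⟨j, b⟩))
        (Matrix.vecMulVec (φ j) (star (φ j : TensorIndex (A.blockDims d j) → ℂ)))
        (fun b => a (A.site ⟨j, b⟩)) := by
  simp only [blochEntry_vecMulVec]
  rw [← A.sum_prod_block (γ := fun i => Fin (d i)) fun j x => ∑ y : TensorIndex (A.blockDims d j),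
    φ j x * star (φ j y) * ∏ b, lam (A.site ⟨j, b⟩) (a (A.site ⟨j, b⟩)) (y b) (x b)]
  refine Finset.sum_congr rfl fun x _ => ?_
  rw [← A.sum_prod_block (γ := fun i => Fin (d i))]
  refine Finset.sum_congr rfl fun y _ => ?_
  rw [Finset.prod_mul_distrib, Finset.prod_mul_distrib, A.prod_site]
  simp [productVector]

theorem blochNormSq_productVector
    (lam : (i : Fin n) → Fin (d i ^ 2 - 1) → Matrix (Fin (d i)) (Fin (d i)) ℂ)
    (φ : (j : Fin m) → EuclideanSpace ℂ (TensorIndex (A.blockDims d j))) :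
    blochNormSq lam (Matrix.vecMulVec (A.productVector d φ) (star (A.productVector d φ))) =
      ∏ j, blochNormSq (d := A.blockDims d j) (fun b => lam (A.site ⟨j, b⟩))
        (Matrix.vecMulVec (φ j) (star (φ j : TensorIndex (A.blockDims d j) → ℂ))) := by
  simp only [blochNormSq]
  rw [← A.sum_prod_block (γ := fun i => Fin (d i ^ 2 - 1))]
  refine Finset.sum_congr rfl fun a _ => ?_
  rw [blochEntry_productVector, norm_prod, Finset.prod_pow]

theorem blochNormSq_le_bound (hd : ∀ i, 2 ≤ d i) (hmono : Monotone d) (hk_pos : ∀ j, 1 ≤ k j)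
    {lam : (i : Fin n) → Fin (d i ^ 2 - 1) → Matrix (Fin (d i)) (Fin (d i)) ℂ}
    (hlam : ∀ i, IsSUGenerators (lam i)) (hA : A.DimOK d) {ψ : TensorIndex d → ℂ}
    (hψ : A.IsProduct d ψ) :
    blochNormSq lam (Matrix.vecMulVec ψ (star ψ)) ≤ A.bound d := by
  obtain ⟨φ, hφ, rfl⟩ := hψ
  rw [blochNormSq_productVector]
  refine Finset.prod_le_prod (fun j _ => Finset.sum_nonneg fun _ _ => by positivity) fun j _ => ?_
  refine blochNormSq_pure_le_blockBound (hk_pos j) (fun b => hd _)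
    (hmono.comp (A.strictMono j).monotone) (hA j) (fun b => hlam _) ?_
  rw [← EuclideanSpace.norm_sq_eq, hφ j, one_pow]

end Arrangement

/-! ### Mixtures -/

/-- Convexity of the squared norm of the Bloch tensor. -/
theorem blochNormSq_sum_le {n N : ℕ} {d : Fin n → ℕ}
    (lam : (i : Fin n) → Fin (d i ^ 2 - 1) → Matrix (Fin (d i)) (Fin (d i)) ℂ)
    (ρ : Fin N → Matrix (TensorIndex d) (TensorIndex d) ℂ) {p : Fin N → ℝ} (hp : ∀ i, 0 ≤ p i)
    (hp1 : ∑ i, p i = 1) :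
    blochNormSq lam (∑ i, (p i : ℂ) • ρ i) ≤ ∑ i, p i * blochNormSq lam (ρ i) := by
  simp only [blochNormSq, Finset.mul_sum]
  rw [Finset.sum_comm]
  refine Finset.sum_le_sum fun a _ => ?_
  have h1 : ‖blochEntry lam (∑ i, (p i : ℂ) • ρ i) a‖ ≤ ∑ i, p i * ‖blochEntry lam (ρ i) a‖ := by
    simp only [blochEntry, Finset.sum_mul, Matrix.trace_sum, Matrix.smul_mul, Matrix.trace_smul]
    refine (norm_sum_le _ _).trans_eq (Finset.sum_congr rfl fun i _ => ?_)
    rw [norm_smul, Complex.norm_real, Real.norm_of_nonneg (hp i)]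
  refine (pow_le_pow_left₀ (norm_nonneg _) h1 2).trans ?_
  exact Real.pow_arith_mean_le_arith_mean_pow _ _ _ (fun i _ => hp i) hp1
    (fun i _ => norm_nonneg _) 2

/-- A weighted average is at most its largest term. The witness is an arrangement of largest bound
among the finitely many that occur in the decomposition. -/
theorem IsSeparableOver.exists_blochNormSq_le_bound {m n : ℕ} {k : Fin m → ℕ} {d : Fin n → ℕ}
    (hd : ∀ i, 2 ≤ d i) (hmono : Monotone d) (hk_pos : ∀ j, 1 ≤ k j)
    {lam : (i : Fin n) → Fin (d i ^ 2 - 1) → Matrix (Fin (d i)) (Fin (d i)) ℂ}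
    (hlam : ∀ i, IsSUGenerators (lam i)) {S : Set (Arrangement k n)} (hS : ∀ A ∈ S, A.DimOK d)
    {ρ : Matrix (TensorIndex d) (TensorIndex d) ℂ} (hρ : IsSeparableOver d S ρ) :
    ∃ A ∈ S, blochNormSq lam ρ ≤ A.bound d := by
  obtain ⟨N, p, ψ, hp, hp1, hψ, rfl⟩ := hρ
  choose A hAS hA using hψ
  have hN : (Finset.univ : Finset (Fin N)).Nonempty := by
    by_contra h
    rw [Finset.not_nonempty_iff_eq_empty] at h
    simp [h] at hp1
  obtain ⟨i₀, -, hi₀⟩ := Finset.exists_max_image _ (fun i => (A i).bound d) hN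
  refine ⟨A i₀, hAS i₀, (blochNormSq_sum_le lam _ (fun i => (hp i).le) hp1).trans ?_⟩
  calc ∑ i, p i * blochNormSq lam (Matrix.vecMulVec (ψ i) (star (ψ i)))
      ≤ ∑ i, p i * (A i₀).bound d := Finset.sum_le_sum fun i _ =>
        mul_le_mul_of_nonneg_left (((A i).blochNormSq_le_bound hd hmono hk_pos hlam
          (hS _ (hAS i)) (hA i)).trans (hi₀ i (Finset.mem_univ i))) (hp i).le
    _ = (A i₀).bound d := by rw [← Finset.sum_mul, hp1, one_mul]

end

theorem theorem2 {n : ℕ} (hn : 3 ≤ n) (d : Fin n → ℕ) (hd : ∀ i, 2 ≤ d i) (hmono : Monotone d)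
    {m : ℕ} (k : Fin m → ℕ) (hk_pos : ∀ j, 1 ≤ k j) (hk_mono : Monotone k)
    (hk_le : ∀ j, k j ≤ n - 1) (hk_sum : ∑ j, k j = n)
    (lam : (i : Fin n) → Fin (d i ^ 2 - 1) → Matrix (Fin (d i)) (Fin (d i)) ℂ)
    (hlam : ∀ i, IsSUGenerators (lam i))
    (ρ : Matrix (TensorIndex d) (TensorIndex d) ℂ) (hρ : IsState ρ) :
    -- separability with respect to the consecutive blocks of sizes `k₁, …, k_m`
    ((consecutive k hk_sum).DimOK d → IsSeparableOver d {consecutive k hk_sum} ρ →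
      blochNormSq lam ρ ≤ (consecutive k hk_sum).bound d) ∧
    -- arbitrary, possibly varying, arrangements of the sites into blocks of these sizes:
    -- the norm is at most the largest of the corresponding products
    (∀ S : Set (Arrangement k n), (∀ A ∈ S, A.DimOK d) → IsSeparableOver d S ρ →
      ∃ A ∈ S, blochNormSq lam ρ ≤ A.bound d) := by
  refine ⟨fun hA hS => ?_, fun S hS hsep =>
    hsep.exists_blochNormSq_le_bound hd hmono hk_pos hlam hS⟩
  obtain ⟨A, rfl, hle⟩ := hS.exists_blochNormSq_le_bound hd hmono hk_pos hlam
    (fun A h => (Set.mem_singleton_iff.1 h) ▸ hA)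
  exact hle
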